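/- Let $K$ be a field. Let $d\ge 0$ and let $b_0\ge b_1\ge\dots\ge b_d>0$ be integers, and let $p\in\mathbb{Q}[z]$ be the Hilbert polynomial $$p(z)=\sum_{i=0}^{d}\left[\binom{z+i}{i+1}-\binom{z+i-b_i}{i+1}\right]$$ (every nonzero Hilbert polynomial of a standard graded $K$-algebra can be written uniquely in this form). Then the number of saturated strongly stable ideals $I\subset R=K[x_0,\dots,x_n]$ such that $R/I$ has Hilbert polynomial $p$ is finite and is the same for all integers $n\ge 0$ with $n\ge b_0+d-1$. Here $R/I$ has Hilbert polynomial $p$ if $\dim_K[R/I]_j=p(j)$ for all sufficiently large $j$; a monomial ideal $I\subset R$ is strongly stable if for every monomial $x^A\in I$, every $x_j$ dividing $x^A$ and every $0\le i<j$ the monomial $\frac{x_i}{x_j}x^A$ is in $I$; and $I$ is saturated if $I:(x_0,\dots,x_n)^k=I$ for all $k\ge 0$. -/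

import Mathlib

open MvPolynomial

/-- The polynomial `binom(z + c, k) = (z + c)(z + c - 1) ⋯ (z + c - k + 1) / k!` in the
variable `z`, for an integer `c` (possibly negative). -/
noncomputable def binomPoly (c : ℤ) (k : ℕ) : Polynomial ℚ :=
  Polynomial.C ((k.factorial : ℚ)⁻¹) *
    (descPochhammer ℚ k).comp (Polynomial.X + Polynomial.C (c : ℚ))

/-- The polynomial `∑_{i=0}^{d} [binom(z + i, i + 1) - binom(z + i - b_i, i + 1)]`. -/
noncomputable def standardHilbertPoly (d : ℕ) (b : Fin (d + 1) → ℤ) : Polynomial ℚ :=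
  ∑ i : Fin (d + 1),
    (binomPoly ((i : ℕ) : ℤ) ((i : ℕ) + 1) - binomPoly (((i : ℕ) : ℤ) - b i) ((i : ℕ) + 1))

/-- `I` is a monomial ideal: it is generated by a set of monomials. -/
def IsMonomialIdeal {K : Type*} [Field K] {n : ℕ} (I : Ideal (MvPolynomial (Fin (n + 1)) K)) :
    Prop :=
  ∃ S : Set (Fin (n + 1) →₀ ℕ), I = Ideal.span ((fun A => monomial A (1 : K)) '' S)

/-- A monomial ideal `I` is strongly stable if for each monomial `x^A ∈ I`, each `x_j` dividing
`x^A` and each `i < j`, the monomial `(x_i / x_j) x^A` is in `I`. -/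
def IsStronglyStable {K : Type*} [Field K] {n : ℕ} (I : Ideal (MvPolynomial (Fin (n + 1)) K)) :
    Prop :=
  IsMonomialIdeal I ∧
    ∀ A : Fin (n + 1) →₀ ℕ, monomial A (1 : K) ∈ I → ∀ j : Fin (n + 1), 0 < A j →
      ∀ i : Fin (n + 1), i < j →
        monomial (A - Finsupp.single j 1 + Finsupp.single i 1) (1 : K) ∈ I

/-- `I` is saturated: `I : 𝔪^k ⊆ I` for all `k`, where `𝔪 = (x_0, …, x_n)`. -/
def IsSaturatedIdeal {K : Type*} [Field K] {n : ℕ} (I : Ideal (MvPolynomial (Fin (n + 1)) K)) :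
    Prop :=
  ∀ (k : ℕ) (f : MvPolynomial (Fin (n + 1)) K),
    (∀ g ∈ (Ideal.span (Set.range X) : Ideal (MvPolynomial (Fin (n + 1)) K)) ^ k, g * f ∈ I) →
      f ∈ I

/-- The Hilbert function of `R/I`: `hilbertFun I j = dim_K [R/I]_j`, where `[R/I]_j` is the image
in `R/I` of the space of homogeneous polynomials of degree `j`. -/
noncomputable def hilbertFun {K : Type*} [Field K] {n : ℕ}
    (I : Ideal (MvPolynomial (Fin (n + 1)) K)) (j : ℕ) : ℕ :=
  Module.finrank K
    ((homogeneousSubmodule (Fin (n + 1)) K j).map (Ideal.Quotient.mkₐ K I).toLinearMap)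

/-- `p` is the Hilbert polynomial of `R/I`: `dim_K [R/I]_j = p(j)` for all large `j`. -/
def HasHilbertPoly {K : Type*} [Field K] {n : ℕ} (I : Ideal (MvPolynomial (Fin (n + 1)) K))
    (p : Polynomial ℚ) : Prop :=
  ∀ᶠ j : ℕ in Filter.atTop, (hilbertFun I j : ℚ) = p.eval (j : ℚ)

/-- The set of saturated strongly stable ideals of `K[x_0, …, x_n]` with Hilbert polynomial `p`. -/
def satStronglyStableIdeals (K : Type*) [Field K] (n : ℕ) (p : Polynomial ℚ) :
    Set (Ideal (MvPolynomial (Fin (n + 1)) K)) :=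
  {I | IsSaturatedIdeal I ∧ IsStronglyStable I ∧ HasHilbertPoly I p}

/-!
A saturated strongly stable ideal is determined by its exponent set `U`, a set of exponent vectors
closed under adding vectors and under moving to earlier variables, in which the last variable can
be cancelled. The complement of such a set is a finite disjoint union of cones
`m · K[x_i, …, x_n]` (`IsSatStable.exists_mem_coneSet`, `eq_of_mem_coneSet`, `finite_coneSet`).
A cone with `a + 1` free variables generated in degree `t` contributes `binom(z + a - t, a)` to the
Hilbert polynomial.

Order the cones by decreasing dimension, then by increasing degree. Below the generator `m` of a
cone of degree `t`, deleting the last variable of `m` repeatedly produces generators of degrees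
`t - 1, …, 0` of cones of at least the same dimension, so `t` is at most the number of cones
before it (`IsSatStable.degree_le_card`). A sum of cones with this property can be rewritten in
Gotzmann's form, where the `s`-th cone has degree exactly `s`, by repeated use of
`binom(z + a - t, a) = binom(z + a - t - 1, a) + binom(z + a - 1 - t, a - 1)`. This never decreases
the number of cones, and Gotzmann's form of the given polynomial has exactly `b_0` cones, of at
most `d + 1` free variables. Since the top coefficient fixes the number of cones of the largest
dimension, the comparison runs by descending induction on the dimension
(`card_le_of_sum_eq_gotzmannPoly`). Hence there are at most `b_0` cones, in degrees below `b_0`,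
which leaves finitely many possibilities for `U` (`finite_satStableSets`).

If `x_0` is not in the ideal, then no variable is. If the cone of `1` is `K[x_i, …, x_n]`, then
`x_0, …, x_{i-1}` generate cones of their own, so `i + 1 ≤ b_0`, while `n - i ≤ d`; thus
`n ≤ b_0 + d - 1` (`IsSatStable.single_zero_mem`). For larger `n` the ideal contains `x_0`, and
dividing by `x_0` is a bijection onto the ideals with one variable less
(`satStableSets_succ`).
-/

/-! ### Binomial polynomials -/

theorem Polynomial.eq_of_eventually_eval_natCast_eq {p q : Polynomial ℚ}
    (h : ∀ᶠ j : ℕ in Filter.atTop, p.eval (j : ℚ) = q.eval (j : ℚ)) : p = q := by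
  refine Polynomial.eq_of_infinite_eval_eq p q ?_
  obtain ⟨N, hN⟩ := Filter.eventually_atTop.1 h
  refine ((Set.Ici_infinite N).image (Nat.cast_injective (R := ℚ)).injOn).mono ?_
  rintro _ ⟨j, hj, rfl⟩
  exact hN j hj

theorem eval_binomPoly {c : ℤ} {j m : ℕ} (k : ℕ) (h : (j : ℤ) + c = m) :
    (binomPoly c k).eval (j : ℚ) = (m.choose k : ℚ) := by
  have h' : (j : ℚ) + c = m := by exact_mod_cast h
  rw [binomPoly, Polynomial.eval_mul, Polynomial.eval_C, Polynomial.eval_comp,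
    Polynomial.eval_add, Polynomial.eval_X, Polynomial.eval_C, h',
    descPochhammer_eval_eq_descFactorial, Nat.descFactorial_eq_factorial_mul_choose]
  have : (k.factorial : ℚ) ≠ 0 := by exact_mod_cast k.factorial_ne_zero
  push_cast
  field_simp

theorem binomPoly_zero (c : ℤ) : binomPoly c 0 = 1 := by
  simp [binomPoly]

theorem binomPoly_pascal (c : ℤ) (k : ℕ) :
    binomPoly (c + 1) (k + 1) = binomPoly c (k + 1) + binomPoly c k := by
  refine Polynomial.eq_of_eventually_eval_natCast_eq ?_
  filter_upwards [Filter.eventually_ge_atTop c.natAbs] with j hj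
  obtain ⟨m, hm⟩ : ∃ m : ℕ, (j : ℤ) + c = m := ⟨((j : ℤ) + c).toNat, by omega⟩
  rw [Polynomial.eval_add, eval_binomPoly (k + 1) hm, eval_binomPoly k hm,
    eval_binomPoly (m := m + 1) (k + 1) (by push_cast; omega), Nat.choose_succ_succ]
  push_cast
  ring

theorem natDegree_binomPoly (c : ℤ) (k : ℕ) : (binomPoly c k).natDegree = k := by
  have : ((k.factorial : ℚ)⁻¹) ≠ 0 := by
    have : (k.factorial : ℚ) ≠ 0 := by exact_mod_cast k.factorial_ne_zero
    exact inv_ne_zero this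
  rw [binomPoly, Polynomial.natDegree_C_mul this, Polynomial.natDegree_comp,
    Polynomial.natDegree_X_add_C, descPochhammer_natDegree, mul_one]

theorem coeff_binomPoly_self (c : ℤ) (k : ℕ) :
    (binomPoly c k).coeff k = (k.factorial : ℚ)⁻¹ := by
  have h : ((descPochhammer ℚ k).comp (Polynomial.X + Polynomial.C (c : ℚ))).Monic :=
    (monic_descPochhammer ℚ k).comp (Polynomial.monic_X_add_C _)
      (by rw [Polynomial.natDegree_X_add_C]; exact one_ne_zero)
  have hd : ((descPochhammer ℚ k).comp (Polynomial.X + Polynomial.C (c : ℚ))).natDegree = k := by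
    rw [Polynomial.natDegree_comp, Polynomial.natDegree_X_add_C, descPochhammer_natDegree, mul_one]
  have := h.coeff_natDegree
  rw [hd] at this
  rw [binomPoly, Polynomial.coeff_C_mul, this, mul_one]

/-- The polynomial `binom(z + a - t, a)`: the Hilbert polynomial of a polynomial ring in `a + 1`
variables with its generator placed in degree `t`. -/
noncomputable def conePoly (a t : ℕ) : Polynomial ℚ :=
  binomPoly ((a : ℤ) - t) a

theorem conePoly_zero (t : ℕ) : conePoly 0 t = 1 := binomPoly_zero _

theorem conePoly_succ (a t : ℕ) :
    conePoly (a + 1) t = conePoly (a + 1) (t + 1) + conePoly a t := by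
  unfold conePoly
  have := binomPoly_pascal ((a : ℤ) - t) a
  rw [show (a : ℤ) - t + 1 = ((a + 1 : ℕ) : ℤ) - t by push_cast; ring] at this
  rw [this, show ((a + 1 : ℕ) : ℤ) - ((t + 1 : ℕ) : ℤ) = (a : ℤ) - t by push_cast; ring]

theorem conePoly_eq_add_sum {a t u : ℕ} (h : t ≤ u) :
    conePoly (a + 1) t = conePoly (a + 1) u + ∑ v ∈ Finset.Ico t u, conePoly a v := by
  induction u, h using Nat.le_induction with
  | base => simp
  | succ u hu ih => rw [ih, Finset.sum_Ico_succ_top hu, conePoly_succ a u]; ring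

theorem coeff_conePoly_self (a t : ℕ) : (conePoly a t).coeff a = (a.factorial : ℚ)⁻¹ :=
  coeff_binomPoly_self _ _

theorem coeff_conePoly_of_lt {a e : ℕ} (h : a < e) (t : ℕ) : (conePoly a t).coeff e = 0 :=
  Polynomial.coeff_eq_zero_of_natDegree_lt (by rwa [conePoly, natDegree_binomPoly])

theorem coeff_sum_map_conePoly_self (a : ℕ) (T : Multiset ℕ) :
    ((T.map (conePoly a)).sum).coeff a = (T.card : ℚ) * (a.factorial : ℚ)⁻¹ := by
  induction T using Multiset.induction with
  | empty => simp
  | cons t T ih => simp [ih, coeff_conePoly_self]; ring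

theorem coeff_sum_map_conePoly_of_lt {a e : ℕ} (h : a < e) (T : Multiset ℕ) :
    ((T.map (conePoly a)).sum).coeff e = 0 := by
  induction T using Multiset.induction with
  | empty => simp
  | cons t T ih => simp [ih, coeff_conePoly_of_lt h]

/-! ### The standard form of a Hilbert polynomial -/

/-- `∑_{a ≤ D} ∑_{b (a + 1) ≤ s < b a} binom(z + a - s, a)`: Gotzmann's representation, with
exactly one cone generated in each degree `s < b 0`, its dimension weakly decreasing in `s`. -/
noncomputable def gotzmannPoly (D : ℕ) (b : ℕ → ℕ) : Polynomial ℚ :=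
  ∑ a ∈ Finset.range (D + 1), ∑ s ∈ Finset.Ico (b (a + 1)) (b a), conePoly a s

theorem gotzmannPoly_succ (D : ℕ) (b : ℕ → ℕ) :
    gotzmannPoly (D + 1) b = gotzmannPoly D b
      + ∑ s ∈ Finset.Ico (b (D + 1 + 1)) (b (D + 1)), conePoly (D + 1) s :=
  Finset.sum_range_succ _ _

theorem sum_range_binomPoly (i m : ℕ) :
    ∑ s ∈ Finset.range m, binomPoly ((i : ℤ) - 1 - s) i
      = binomPoly (i : ℤ) (i + 1) - binomPoly ((i : ℤ) - m) (i + 1) := by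
  induction m with
  | zero => simp
  | succ m ih =>
    rw [Finset.sum_range_succ, ih]
    have := binomPoly_pascal ((i : ℤ) - 1 - m) i
    rw [show (i : ℤ) - 1 - m + 1 = (i : ℤ) - m by ring] at this
    rw [this]
    push_cast
    rw [show (i : ℤ) - (m + 1) = (i : ℤ) - 1 - m by ring]
    ring

theorem gotzmannPoly_add_sum (D : ℕ) {b : ℕ → ℕ} (hb : Antitone b) :
    gotzmannPoly D b + ∑ s ∈ Finset.range (b (D + 1)), conePoly D s
      = ∑ i ∈ Finset.range (D + 1),
          (binomPoly (i : ℤ) (i + 1) - binomPoly ((i : ℤ) - b i) (i + 1)) := by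
  have hcone : ∀ a s : ℕ, conePoly (a + 1) s
      = conePoly a s + binomPoly (((a + 1 : ℕ) : ℤ) - 1 - s) (a + 1) := by
    intro a s
    rw [conePoly_succ, add_comm]
    congr 1
    unfold conePoly
    congr 1
    push_cast
    ring
  induction D with
  | zero =>
    have := Finset.sum_range_add_sum_Ico (conePoly 0) (hb (Nat.zero_le 1))
    rw [gotzmannPoly, Finset.sum_range_one, Finset.sum_range_one, zero_add, add_comm, this,
      ← sum_range_binomPoly]
    simp [conePoly_zero, binomPoly_zero]
  | succ D ih =>
    have h1 := Finset.sum_range_add_sum_Ico (conePoly (D + 1)) (hb (Nat.le_succ (D + 1)))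
    rw [Nat.succ_eq_add_one] at h1
    have h2 : ∑ s ∈ Finset.range (b (D + 1)), conePoly (D + 1) s
        = ∑ s ∈ Finset.range (b (D + 1)), conePoly D s
          + (binomPoly ((D + 1 : ℕ) : ℤ) (D + 1 + 1)
            - binomPoly (((D + 1 : ℕ) : ℤ) - b (D + 1)) (D + 1 + 1)) := by
      rw [← sum_range_binomPoly, ← Finset.sum_add_distrib]
      exact Finset.sum_congr rfl fun s _ => hcone D s
    rw [gotzmannPoly_succ, Finset.sum_range_succ _ (D + 1)]
    linear_combination ih + h1 + h2

theorem standardHilbertPoly_eq_gotzmannPoly {d : ℕ} {b : Fin (d + 1) → ℤ} {b' : ℕ → ℕ}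
    (hb' : Antitone b') (h : ∀ i : Fin (d + 1), (b' i : ℤ) = b i) (h0 : ∀ i, d < i → b' i = 0)
    {D : ℕ} (hD : d ≤ D) : standardHilbertPoly d b = gotzmannPoly D b' := by
  have := gotzmannPoly_add_sum D hb'
  rw [h0 (D + 1) (by omega), Finset.sum_range_zero, add_zero] at this
  rw [this, standardHilbertPoly, ← Finset.sum_range_add_sum_Ico _ (Nat.succ_le_succ hD),
    Finset.sum_eq_zero (s := Finset.Ico _ _), add_zero, Finset.sum_range]
  · simp_rw [h]
  · intro i hi
    rw [Finset.mem_Ico] at hi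
    rw [h0 i (by omega)]
    simp

/-! ### Comparison of a sum of cones with the standard form -/

/-- A multiset of degrees whose `s`-th smallest element is at most `k + s` is pushed up to the
degrees `k, k + 1, …` at the cost of cones of one dimension less, all in degrees below `k + T.card`. -/
theorem exists_sum_map_conePoly_succ_eq (a k : ℕ) (T : Multiset ℕ)
    (hT : ∀ t ∈ T, t ≤ k + (T.filter (· < t)).card) :
    ∃ E : Multiset ℕ, (∀ u ∈ E, u < k + T.card) ∧
      (T.map (conePoly (a + 1))).sum
        = ∑ s ∈ Finset.Ico k (k + T.card), conePoly (a + 1) s + (E.map (conePoly a)).sum := by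
  induction hn : T.card generalizing T with
  | zero =>
    rw [Multiset.card_eq_zero] at hn
    subst hn
    exact ⟨0, by simp, by simp⟩
  | succ n ih =>
    obtain ⟨t, ht, hmax⟩ := Multiset.exists_max_image id (s := T) (by
      rintro rfl; simp at hn)
    obtain ⟨T, rfl⟩ := Multiset.exists_cons_of_mem ht
    simp only [id, Multiset.card_cons, Nat.add_right_cancel_iff] at hmax hn
    have hle : t ≤ k + n := by
      refine (hT t ht).trans ?_
      rw [Multiset.filter_cons_of_neg (p := (· < t)) _ (lt_irrefl t), ← hn]
      exact Nat.add_le_add_left (Multiset.card_le_card (Multiset.filter_le _ _)) _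
    obtain ⟨E, hE, hsum⟩ := ih T (fun u hu => by
      have := hT u (Multiset.mem_cons_of_mem hu)
      rwa [Multiset.filter_cons_of_neg] at this
      exact not_lt.2 (hmax u (Multiset.mem_cons_of_mem hu))) hn
    refine ⟨E + (Finset.Ico t (k + n)).val, ?_, ?_⟩
    · intro u hu
      rcases Multiset.mem_add.1 hu with hu | hu
      · have := hE u hu
        omega
      · have := Finset.mem_Ico.1 (Finset.mem_def.2 hu)
        omega
    · rw [Multiset.map_cons, Multiset.sum_cons, hsum, conePoly_eq_add_sum hle, ← add_assoc k n 1,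
        Finset.sum_Ico_succ_top (Nat.le_add_right k n), Multiset.map_add, Multiset.sum_add]
      change _ + (Finset.Ico t (k + n)).sum _ + _ = _ + (_ + (Finset.Ico t (k + n)).sum _)
      ring

theorem card_eq_of_sum_eq_gotzmannPoly {D : ℕ} {T : ℕ → Multiset ℕ} {b : ℕ → ℕ}
    (h : ∑ a ∈ Finset.range (D + 1), ((T a).map (conePoly a)).sum = gotzmannPoly D b) :
    (T D).card = b D - b (D + 1) := by
  have h' := congrArg (fun q => Polynomial.coeff q D) h
  have key : ∀ S : ℕ → Multiset ℕ,
      (∑ a ∈ Finset.range (D + 1), ((S a).map (conePoly a)).sum).coeff D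
        = ((S D).card : ℚ) * (D.factorial : ℚ)⁻¹ := by
    intro S
    rw [Finset.sum_range_succ, Polynomial.coeff_add, Polynomial.finsetSum_coeff,
      Finset.sum_eq_zero, zero_add, coeff_sum_map_conePoly_self]
    intro a ha
    exact coeff_sum_map_conePoly_of_lt (Finset.mem_range.1 ha) _
  have h2 := key (fun a => (Finset.Ico (b (a + 1)) (b a)).val)
  change (gotzmannPoly D b).coeff D = _ at h2
  simp only [key, h2] at h'
  have : (D.factorial : ℚ) ≠ 0 := by exact_mod_cast D.factorial_ne_zero
  have h3 := mul_right_cancel₀ (inv_ne_zero this) h'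
  have h4 : (T D).card = (Finset.Ico (b (D + 1)) (b D)).val.card := by exact_mod_cast h3
  rw [h4]
  exact Nat.card_Ico _ _

/-- Let the cones of dimension `a + 1` be generated in the degrees `T a`, and order all cones by
decreasing dimension and then by increasing degree. If the degree of each cone is at most `k` plus
the number of cones before it, and their total is in Gotzmann's form with degrees starting at
`k`, then there are at most `b 0 - k` cones, and each dimension that occurs also occurs in
Gotzmann's form. -/
theorem card_le_of_sum_eq_gotzmannPoly (D : ℕ) (T : ℕ → Multiset ℕ) {b : ℕ → ℕ} (hb : Antitone b)
    (hT : ∀ a ≤ D, ∀ t ∈ T a, t ≤ b (D + 1) + ∑ e ∈ Finset.Ico (a + 1) (D + 1), (T e).card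
      + ((T a).filter (· < t)).card)
    (h : ∑ a ∈ Finset.range (D + 1), ((T a).map (conePoly a)).sum = gotzmannPoly D b) :
    b (D + 1) + ∑ a ∈ Finset.range (D + 1), (T a).card ≤ b 0 ∧
      ∀ a ≤ D, T a ≠ 0 → b (a + 1) < b a := by
  induction D generalizing T with
  | zero =>
    have hc := card_eq_of_sum_eq_gotzmannPoly h
    have hb0 := hb (Nat.zero_le 1)
    rw [Finset.sum_range_one]
    refine ⟨by rw [hc]; simp only [zero_add]; omega, ?_⟩
    intro a ha hne
    obtain rfl : a = 0 := by omega
    have := Multiset.card_pos.2 hne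
    omega
  | succ D ih =>
    have hc := card_eq_of_sum_eq_gotzmannPoly h
    have hbD := hb (Nat.le_succ (D + 1))
    rw [Nat.succ_eq_add_one] at hbD
    have hk : b (D + 1 + 1) + (T (D + 1)).card = b (D + 1) := by omega
    obtain ⟨E, hE, hsum⟩ := exists_sum_map_conePoly_succ_eq D (b (D + 1 + 1)) (T (D + 1))
      (fun t ht => by simpa using hT (D + 1) le_rfl t ht)
    rw [hk] at hsum hE
    -- The correction terms are appended to the cones one dimension below.
    set T' : ℕ → Multiset ℕ := fun a => if a = D then T D + E else T a with hT'
    have hT'D : T' D = T D + E := if_pos rfl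
    have hT'ne : ∀ a, a ≠ D → T' a = T a := fun a ha => if_neg ha
    have hTle : ∀ a, T a ≤ T' a := by
      intro a
      by_cases ha : a = D
      · subst ha
        rw [hT'D]
        exact Multiset.le_add_right _ _
      · rw [hT'ne a ha]
    obtain ⟨h1, h2⟩ := ih T' (by
      intro a ha t ht
      have hold : t ∈ T a → t ≤ b (D + 1) + ∑ e ∈ Finset.Ico (a + 1) (D + 1), (T' e).card
          + ((T' a).filter (· < t)).card := by
        intro ht
        refine (hT a (by omega) t ht).trans ?_
        rw [Finset.sum_Ico_succ_top (by omega), ← hk]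
        have h3 : ∑ e ∈ Finset.Ico (a + 1) (D + 1), (T e).card
            ≤ ∑ e ∈ Finset.Ico (a + 1) (D + 1), (T' e).card :=
          Finset.sum_le_sum fun e _ => Multiset.card_le_card (hTle e)
        have h4 : ((T a).filter (· < t)).card ≤ ((T' a).filter (· < t)).card :=
          Multiset.card_le_card (Multiset.filter_le_filter _ (hTle a))
        omega
      by_cases haD : a = D
      · subst haD
        rw [hT'D] at ht
        rcases Multiset.mem_add.1 ht with ht | ht
        · exact hold ht
        · have := hE t ht
          omega
      · rw [hT'ne a haD] at ht
        exact hold ht) (by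
      rw [gotzmannPoly_succ, Finset.sum_range_succ _ (D + 1), hsum,
        Finset.sum_range_succ _ D] at h
      rw [Finset.sum_range_succ, hT'D, Multiset.map_add, Multiset.sum_add]
      have : ∑ a ∈ Finset.range D, ((T' a).map (conePoly a)).sum
          = ∑ a ∈ Finset.range D, ((T a).map (conePoly a)).sum :=
        Finset.sum_congr rfl fun a ha => by rw [hT'ne a (Finset.mem_range.1 ha).ne]
      rw [this]
      linear_combination h)
    constructor
    · refine le_trans ?_ h1
      rw [Finset.sum_range_succ _ (D + 1), ← hk]
      have : ∑ a ∈ Finset.range (D + 1), (T a).card ≤ ∑ a ∈ Finset.range (D + 1), (T' a).card :=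
        Finset.sum_le_sum fun e _ => Multiset.card_le_card (hTle e)
      omega
    · intro a ha hne
      by_cases haD : a = D + 1
      · subst haD
        have := Multiset.card_pos.2 hne
        omega
      · refine h2 a (by omega) fun h0 => hne ?_
        have := hTle a
        rw [h0] at this
        exact Multiset.le_zero.1 this

/-! ### Exponent sets and initial segments of exponent vectors -/

open Finsupp in
/-- The exponent sets of saturated strongly stable ideals: closed under multiplication by
monomials and under replacing a variable by an earlier one, and such that the last variable can
be cancelled. -/
structure IsSatStable {n : ℕ} (U : Set (Fin (n + 1) →₀ ℕ)) : Prop where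
  add_mem : ∀ A ∈ U, ∀ B, A + B ∈ U
  move_mem : ∀ A i j, i < j → A + single j 1 ∈ U → A + single i 1 ∈ U
  mem_of_add_last : ∀ A, A + single (Fin.last n) 1 ∈ U → A ∈ U

/-- The part of an exponent vector on the variables `x_0, …, x_{i-1}`. -/
noncomputable def initialPart {n : ℕ} (i : ℕ) (A : Fin (n + 1) →₀ ℕ) : Fin (n + 1) →₀ ℕ :=
  A.filter (fun x => (x : ℕ) < i)

section InitialPart

variable {n : ℕ}

theorem initialPart_apply (i : ℕ) (A : Fin (n + 1) →₀ ℕ) (x : Fin (n + 1)) :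
    initialPart i A x = if (x : ℕ) < i then A x else 0 := by
  classical
  rw [initialPart, Finsupp.filter_apply]

theorem initialPart_initialPart {i k : ℕ} (h : i ≤ k) (A : Fin (n + 1) →₀ ℕ) :
    initialPart i (initialPart k A) = initialPart i A := by
  ext x
  simp only [initialPart_apply]
  split_ifs <;> first | rfl | omega

theorem initialPart_zero (A : Fin (n + 1) →₀ ℕ) : initialPart 0 A = 0 := by
  ext x
  simp [initialPart_apply]

theorem initialPart_eq_self_iff {i : ℕ} {A : Fin (n + 1) →₀ ℕ} :
    initialPart i A = A ↔ ∀ x : Fin (n + 1), i ≤ x → A x = 0 := by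
  rw [Finsupp.ext_iff]
  refine forall_congr' fun x => ?_
  rw [initialPart_apply]
  split_ifs with h
  · simp [not_le.2 h]
  · simp [not_lt.1 h, eq_comm]

theorem initialPart_succ (x : Fin (n + 1)) (A : Fin (n + 1) →₀ ℕ) :
    initialPart (x + 1) A = initialPart x A + Finsupp.single x (A x) := by
  ext y
  rw [Finsupp.add_apply, initialPart_apply, initialPart_apply, Finsupp.single_apply]
  by_cases h : x = y
  · subst h
    simp
  · have : (x : ℕ) ≠ y := fun h' => h (Fin.ext h')
    rw [if_neg h, add_zero]
    split_ifs <;> first | rfl | omega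

theorem initialPart_add_of_le {i : ℕ} {j : Fin (n + 1)} (h : i ≤ j) (A : Fin (n + 1) →₀ ℕ)
    (k : ℕ) : initialPart i (A + Finsupp.single j k) = initialPart i A := by
  ext y
  rw [initialPart_apply, initialPart_apply, Finsupp.add_apply, Finsupp.single_apply]
  split_ifs with h1 h2
  · subst h2
    omega
  · rw [add_zero]
  · rfl

theorem exists_eq_initialPart_add (i : ℕ) (A : Fin (n + 1) →₀ ℕ) :
    ∃ W : Fin (n + 1) →₀ ℕ, (∀ x : Fin (n + 1), (x : ℕ) < i → W x = 0) ∧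
      A = initialPart i A + W := by
  refine ⟨A.filter (fun x => ¬ (x : ℕ) < i), fun x hx => ?_, ?_⟩
  · exact Finsupp.filter_apply_neg _ _ (not_not.2 hx)
  · exact (Finsupp.filter_add_filter_not A _).symm

end InitialPart

/-! ### The decomposition of the complement into cones -/

/-- The pairs `(m, i)`, standing for the cones `m · K[x_i, …, x_n]`, that decompose the set of
monomials outside `U`: the monomial `m` involves only `x_0, …, x_{i-1}`, no `m x_i ^ k` is in `U`,
and `i` is the first index with this property along the initial parts of `m`. -/
def coneSet {n : ℕ} (U : Set (Fin (n + 1) →₀ ℕ)) : Set ((Fin (n + 1) →₀ ℕ) × Fin (n + 1)) :=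
  {c | initialPart c.2 c.1 = c.1 ∧ (∀ k, c.1 + Finsupp.single c.2 k ∉ U) ∧
    ∀ i < c.2, ∃ k, initialPart i c.1 + Finsupp.single i k ∈ U}

namespace IsSatStable

variable {n : ℕ} {U : Set (Fin (n + 1) →₀ ℕ)}

theorem mem_of_add_single_last (hU : IsSatStable U) {A : Fin (n + 1) →₀ ℕ} {k : ℕ}
    (h : A + Finsupp.single (Fin.last n) k ∈ U) : A ∈ U := by
  induction k with
  | zero => simpa using h
  | succ k ih =>
    rw [Finsupp.single_add, ← add_assoc] at h
    exact ih (hU.mem_of_add_last _ h)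

theorem move_single_mem (hU : IsSatStable U) {A : Fin (n + 1) →₀ ℕ} {i j : Fin (n + 1)}
    (hij : i ≤ j) {k : ℕ} (h : A + Finsupp.single j k ∈ U) : A + Finsupp.single i k ∈ U := by
  rcases hij.eq_or_lt with rfl | hij
  · exact h
  induction k generalizing A with
  | zero => simpa using h
  | succ k ih =>
    rw [Finsupp.single_add, ← add_assoc] at h ⊢
    have h1 := hU.move_mem _ _ _ hij h
    rw [add_right_comm] at h1 ⊢
    exact ih h1

/-- All variables from `x_i` on may be replaced by `x_i`. -/
theorem add_single_degree_mem (hU : IsSatStable U) (i : Fin (n + 1)) (W A : Fin (n + 1) →₀ ℕ)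
    (hW : ∀ x : Fin (n + 1), (x : ℕ) < i → W x = 0) (h : A + W ∈ U) :
    A + Finsupp.single i W.degree ∈ U := by
  induction W using Finsupp.induction_linear generalizing A with
  | zero => simpa using h
  | add f g hf hg =>
    have hfg : ∀ x : Fin (n + 1), (x : ℕ) < i → f x = 0 ∧ g x = 0 := fun x hx => by
      have := hW x hx
      rw [Finsupp.add_apply] at this
      omega
    have h1 := hf (A + g) (fun x hx => (hfg x hx).1) (by rwa [add_assoc, add_comm g f])
    have h2 := hg (A + Finsupp.single i f.degree) (fun x hx => (hfg x hx).2)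
      (by rwa [add_right_comm])
    rwa [map_add, Finsupp.single_add, ← add_assoc]
  | single j k =>
    rw [Finsupp.degree_single]
    rcases Nat.eq_zero_or_pos k with rfl | hk
    · simpa using h
    refine hU.move_single_mem (Fin.le_def.2 ?_) h
    by_contra hlt
    have := hW j (by omega)
    rw [Finsupp.single_eq_same] at this
    omega

theorem exists_mem_coneSet (hU : IsSatStable U) {A : Fin (n + 1) →₀ ℕ} (hA : A ∉ U) :
    ∃ c ∈ coneSet U, initialPart c.2 A = c.1 := by
  have hne : {i : Fin (n + 1) | ∀ k, initialPart i A + Finsupp.single i k ∉ U}.Nonempty := by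
    refine ⟨Fin.last n, fun k hk => hA ?_⟩
    obtain ⟨W, -, hW⟩ := exists_eq_initialPart_add (Fin.last n) A
    rw [hW]
    exact hU.add_mem _ (hU.mem_of_add_single_last hk) _
  obtain ⟨i, hi, hmin⟩ := wellFounded_lt.has_min _ hne
  refine ⟨(initialPart i A, i), ⟨initialPart_initialPart le_rfl _, hi, fun l hl => ?_⟩, rfl⟩
  have := fun h => hmin l h hl
  simp only [Set.mem_ofPred_eq, imp_false, not_forall, not_not] at this
  obtain ⟨k, hk⟩ := this
  exact ⟨k, by rwa [initialPart_initialPart (Fin.le_def.1 hl.le)]⟩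

theorem notMem_of_mem_coneSet (hU : IsSatStable U) {c : (Fin (n + 1) →₀ ℕ) × Fin (n + 1)}
    (hc : c ∈ coneSet U) {A : Fin (n + 1) →₀ ℕ} (h : initialPart c.2 A = c.1) : A ∉ U := by
  intro hA
  obtain ⟨W, hW0, hW⟩ := exists_eq_initialPart_add c.2 A
  rw [hW, h] at hA
  exact hc.2.1 _ (hU.add_single_degree_mem c.2 W c.1 hW0 hA)

end IsSatStable

section Cones

variable {n : ℕ} {U : Set (Fin (n + 1) →₀ ℕ)}

theorem eq_of_mem_coneSet {c c' : (Fin (n + 1) →₀ ℕ) × Fin (n + 1)} (hc : c ∈ coneSet U)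
    (hc' : c' ∈ coneSet U) {A : Fin (n + 1) →₀ ℕ} (h : initialPart c.2 A = c.1)
    (h' : initialPart c'.2 A = c'.1) : c = c' := by
  have aux : ∀ {c c' : (Fin (n + 1) →₀ ℕ) × Fin (n + 1)}, c ∈ coneSet U → c' ∈ coneSet U →
      initialPart c.2 A = c.1 → initialPart c'.2 A = c'.1 → c'.2 ≤ c.2 := by
    intro c c' hc hc' h h'
    by_contra! hlt
    obtain ⟨k, hk⟩ := hc'.2.2 _ hlt
    rw [← h', initialPart_initialPart (Fin.le_def.1 hlt.le), h] at hk
    exact hc.2.1 k hk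
  have h2 : c.2 = c'.2 := le_antisymm (aux hc' hc h' h) (aux hc hc' h h')
  exact Prod.ext (by rw [← h, ← h', h2]) h2

theorem finite_coneSet (hU : ∀ A ∈ U, ∀ B, A + B ∈ U) : (coneSet U).Finite := by
  -- The prefixes that occur form a finitely branching tree of depth `n + 1`.
  set P : ℕ → Set (Fin (n + 1) →₀ ℕ) := fun i => {m | initialPart i m = m ∧ m ∉ U ∧
    ∀ l : Fin (n + 1), (l : ℕ) < i → ∃ k, initialPart l m + Finsupp.single l k ∈ U} with hP
  have hfin : ∀ i ≤ n + 1, (P i).Finite := by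
    intro i
    induction i with
    | zero =>
      intro _
      refine (Set.finite_singleton 0).subset fun m hm => ?_
      rw [Set.mem_singleton_iff, ← hm.1, initialPart_zero]
    | succ i ih =>
      intro hi
      set x : Fin (n + 1) := ⟨i, by omega⟩
      have hQ : ∀ m' ∈ P i, {m | m ∈ P (i + 1) ∧ initialPart i m = m'}.Finite := by
        intro m' _
        by_cases hk : ∃ k, m' + Finsupp.single x k ∈ U
        · obtain ⟨k, hk⟩ := hk
          refine ((Set.finite_Iio k).image fun a => m' + Finsupp.single x a).subset ?_
          rintro m ⟨hm, hm'⟩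
          have hmx : m = m' + Finsupp.single x (m x) := by
            rw [← hm', ← initialPart_succ x m]
            exact hm.1.symm
          refine ⟨m x, ?_, hmx.symm⟩
          by_contra hlt
          obtain ⟨e, he⟩ := Nat.exists_eq_add_of_le (not_lt.1 hlt)
          rw [he, Finsupp.single_add, ← add_assoc] at hmx
          exact hm.2.1 (hmx ▸ hU _ hk _)
        · refine Set.finite_empty.subset ?_
          rintro m ⟨hm, hm'⟩
          obtain ⟨k, hk'⟩ := hm.2.2 x (Nat.lt_succ_self i)
          exact hk ⟨k, by rw [← hm']; exact hk'⟩
      refine ((ih (by omega)).biUnion hQ).subset fun m hm => ?_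
      refine Set.mem_biUnion (x := initialPart i m) ⟨initialPart_initialPart le_rfl _, ?_, ?_⟩
        ⟨hm, rfl⟩
      · intro h
        obtain ⟨W, -, hW⟩ := exists_eq_initialPart_add i m
        exact hm.2.1 (by rw [hW]; exact hU _ h _)
      · intro l hl
        rw [initialPart_initialPart hl.le]
        exact hm.2.2 l (by omega)
  refine (Set.finite_iUnion fun i : Fin (n + 1) =>
    (hfin i i.2.le).prod (Set.finite_singleton i)).subset fun c hc => ?_
  refine Set.mem_iUnion.2 ⟨c.2, ⟨hc.1, ?_, fun l hl => hc.2.2 l (Fin.lt_def.2 hl)⟩, rfl⟩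
  simpa using hc.2.1 0

/-- Removing the last variable from the generator of a cone gives the generator of a cone of at
least the same dimension. -/
theorem IsSatStable.exists_mem_coneSet_degree_pred (hU : IsSatStable U)
    {c : (Fin (n + 1) →₀ ℕ) × Fin (n + 1)} (hc : c ∈ coneSet U) {t : ℕ}
    (ht : c.1.degree = t + 1) : ∃ c' ∈ coneSet U, c'.1.degree = t ∧ c'.2 ≤ c.2 := by
  have hne : c.1.support.Nonempty := by
    rw [Finset.nonempty_iff_ne_empty, Ne, Finsupp.support_eq_empty]
    intro h
    rw [h] at ht
    simp at ht
  set j := c.1.support.max' hne with hj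
  have hj0 : c.1 j ≠ 0 := Finsupp.mem_support_iff.1 (c.1.support.max'_mem hne)
  have hjmax : ∀ x, j < x → c.1 x = 0 := fun x hx => by
    by_contra h
    exact absurd (c.1.support.le_max' x (Finsupp.mem_support_iff.2 h)) (not_le.2 hx)
  obtain ⟨m', hm'⟩ : ∃ m', c.1 = m' + Finsupp.single j 1 :=
    ⟨c.1 - Finsupp.single j 1, (tsub_add_cancel_of_le (by
      rw [Finsupp.single_le_iff]; omega)).symm⟩
  have hmem : ∀ B, m' + B ∈ U → c.1 + B ∈ U := fun B hB => by
    rw [hm', add_right_comm]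
    exact hU.add_mem _ hB _
  have hjc : j < c.2 := by
    by_contra h
    exact hj0 (initialPart_eq_self_iff.1 hc.1 j (Fin.le_def.1 (not_lt.1 h)))
  have hm'U : m' ∉ U := fun h => by
    have := hmem 0 (by rwa [add_zero])
    exact hc.2.1 0 (by rwa [Finsupp.single_zero])
  obtain ⟨c', hc', h'⟩ := hU.exists_mem_coneSet hm'U
  have hjc' : j < c'.2 := by
    by_contra h
    obtain ⟨k, hk⟩ := hc.2.2 c'.2 (lt_of_le_of_lt (not_lt.1 h) hjc)
    rw [hm', initialPart_add_of_le (Fin.le_def.1 (not_lt.1 h)), h'] at hk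
    exact hc'.2.1 k hk
  have hself : ∀ i : Fin (n + 1), j < i → initialPart i m' = m' := fun i hi =>
    initialPart_eq_self_iff.2 fun x hx => by
      have := hjmax x (lt_of_lt_of_le hi (Fin.le_def.2 hx))
      rw [hm', Finsupp.add_apply] at this
      omega
  rw [hself _ hjc'] at h'
  refine ⟨c', hc', ?_, ?_⟩
  · rw [hm', map_add, Finsupp.degree_single] at ht
    rw [← h']
    omega
  · by_contra! hlt
    obtain ⟨k, hk⟩ := hc'.2.2 _ hlt
    rw [← h', hself _ hjc] at hk
    exact hc.2.1 k (hmem _ hk)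

theorem IsSatStable.exists_mem_coneSet_degree_eq (hU : IsSatStable U)
    {c : (Fin (n + 1) →₀ ℕ) × Fin (n + 1)} (hc : c ∈ coneSet U) {s : ℕ} (hs : s ≤ c.1.degree) :
    ∃ c' ∈ coneSet U, c'.1.degree = s ∧ c'.2 ≤ c.2 := by
  induction hs using Nat.decreasingInduction with
  | self => exact ⟨c, hc, rfl, le_rfl⟩
  | of_succ k _ ih =>
    obtain ⟨c', hc', h1, h2⟩ := ih
    obtain ⟨c'', hc'', h3, h4⟩ := hU.exists_mem_coneSet_degree_pred hc' h1
    exact ⟨c'', hc'', h3, h4.trans h2⟩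

/-! ### The Hilbert polynomial of an exponent set -/

theorem ncard_cone (c : (Fin (n + 1) →₀ ℕ) × Fin (n + 1)) (hc : initialPart c.2 c.1 = c.1) {j : ℕ}
    (hj : c.1.degree ≤ j) :
    {A : Fin (n + 1) →₀ ℕ | initialPart c.2 A = c.1 ∧ A.degree = j}.ncard
      = (j - c.1.degree + (n - c.2)).choose (n - c.2) := by
  have hset : {A : Fin (n + 1) →₀ ℕ | initialPart c.2 A = c.1 ∧ A.degree = j}
      = (fun W => c.1 + W) '' (Finset.finsuppAntidiag (Finset.Ici c.2) (j - c.1.degree) :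
        Set (Fin (n + 1) →₀ ℕ)) := by
    ext A
    simp only [Set.mem_ofPred_eq, Set.mem_image, Finset.mem_coe, Finset.mem_finsuppAntidiag]
    constructor
    · rintro ⟨h1, h2⟩
      obtain ⟨W, hW0, hW⟩ := exists_eq_initialPart_add c.2 A
      rw [h1] at hW
      have hsup : W.support ⊆ Finset.Ici c.2 := fun x hx => by
        rw [Finset.mem_Ici]
        by_contra h
        exact Finsupp.mem_support_iff.1 hx (hW0 x (Fin.lt_def.1 (not_le.1 h)))
      refine ⟨W, ⟨?_, hsup⟩, hW.symm⟩
      rw [← Finset.sum_subset hsup (fun x _ hx => Finsupp.notMem_support_iff.1 hx),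
        ← Finsupp.degree_apply]
      rw [hW, map_add] at h2
      omega
    · rintro ⟨W, ⟨h1, hsup⟩, rfl⟩
      constructor
      · ext x
        have hcx := DFunLike.congr_fun hc x
        rw [initialPart_apply] at hcx ⊢
        split_ifs at hcx ⊢ with h
        · have : W x = 0 := by
            by_contra h0
            have := Fin.le_def.1 (Finset.mem_Ici.1 (hsup (Finsupp.mem_support_iff.2 h0)))
            omega
          rw [Finsupp.add_apply, this, add_zero]
        · exact hcx
      · have : W.degree = j - c.1.degree := by
          rw [← h1, ← Finset.sum_subset hsup (fun x _ hx => Finsupp.notMem_support_iff.1 hx),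
            ← Finsupp.degree_apply]
        rw [map_add, this]
        omega
  rw [hset, Set.ncard_image_of_injective _ (add_right_injective c.1), Set.ncard_coe_finset,
    Finset.card_finsuppAntidiag_nat_eq_choose, Fin.card_Ici]
  have hn : n + 1 - (c.2 : ℕ) = n - c.2 + 1 := by have := c.2.2; omega
  rw [hn, show n - (c.2 : ℕ) + 1 + (j - c.1.degree) - 1 = j - c.1.degree + (n - c.2) by omega]
  conv_rhs => rw [← Nat.choose_symm_add]

/-- The number of monomials of degree `j` outside `U`. -/
noncomputable def complCount (U : Set (Fin (n + 1) →₀ ℕ)) (j : ℕ) : ℕ :=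
  {A : Fin (n + 1) →₀ ℕ | A ∉ U ∧ A.degree = j}.ncard

theorem IsSatStable.complCount_eq_sum (hU : IsSatStable U)
    {C : Finset ((Fin (n + 1) →₀ ℕ) × Fin (n + 1))} (hC : (C : Set _) = coneSet U) {j : ℕ}
    (hj : ∀ c ∈ C, c.1.degree ≤ j) :
    complCount U j = ∑ c ∈ C, (j - c.1.degree + (n - c.2)).choose (n - c.2) := by
  have hmem : ∀ {c}, c ∈ C ↔ c ∈ coneSet U := fun {c} => by rw [← hC, Finset.mem_coe]
  have hset : {A : Fin (n + 1) →₀ ℕ | A ∉ U ∧ A.degree = j}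
      = ⋃ c ∈ C, {A : Fin (n + 1) →₀ ℕ | initialPart c.2 A = c.1 ∧ A.degree = j} := by
    ext A
    simp only [Set.mem_ofPred_eq, Set.mem_iUnion, exists_prop]
    constructor
    · rintro ⟨h1, h2⟩
      obtain ⟨c, hc, h⟩ := hU.exists_mem_coneSet h1
      exact ⟨c, hmem.2 hc, h, h2⟩
    · rintro ⟨c, hc, h, h2⟩
      exact ⟨hU.notMem_of_mem_coneSet (hmem.1 hc) h, h2⟩
  have hfin : ∀ c : (Fin (n + 1) →₀ ℕ) × Fin (n + 1),
      {A : Fin (n + 1) →₀ ℕ | initialPart c.2 A = c.1 ∧ A.degree = j}.Finite := fun c =>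
    (Finsupp.finite_of_degree_eq j).subset fun A hA => hA.2
  classical
  rw [complCount, hset]
  have : (⋃ c ∈ C, {A : Fin (n + 1) →₀ ℕ | initialPart c.2 A = c.1 ∧ A.degree = j})
      = (C.biUnion fun c => (hfin c).toFinset : Set (Fin (n + 1) →₀ ℕ)) := by
    simp
  rw [this, Set.ncard_coe_finset, Finset.card_biUnion]
  · refine Finset.sum_congr rfl fun c hc => ?_
    rw [← ncard_cone c (hmem.1 hc).1 (hj c hc), Set.ncard_eq_toFinset_card _ (hfin c)]
  · intro c hc c' hc' hne
    rw [Function.onFun, Finset.disjoint_left]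
    intro A hA hA'
    rw [Set.Finite.mem_toFinset] at hA hA'
    exact hne (eq_of_mem_coneSet (hmem.1 hc) (hmem.1 hc') hA.1 hA'.1)

theorem IsSatStable.eq_sum_conePoly (hU : IsSatStable U)
    {C : Finset ((Fin (n + 1) →₀ ℕ) × Fin (n + 1))} (hC : (C : Set _) = coneSet U)
    {p : Polynomial ℚ} (hp : ∀ᶠ j : ℕ in Filter.atTop, (complCount U j : ℚ) = p.eval (j : ℚ)) :
    p = ∑ c ∈ C, conePoly (n - c.2) c.1.degree := by
  refine Polynomial.eq_of_eventually_eval_natCast_eq ?_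
  filter_upwards [hp, Filter.eventually_ge_atTop (C.sup fun c => c.1.degree)] with j h1 h2
  have hle : ∀ c ∈ C, c.1.degree ≤ j := fun c hc =>
    (Finset.le_sup (f := fun c => c.1.degree) hc).trans h2
  rw [← h1, hU.complCount_eq_sum hC hle, Polynomial.eval_finsetSum, Nat.cast_sum]
  refine Finset.sum_congr rfl fun c hc => ?_
  have := hle c hc
  rw [conePoly, eval_binomPoly (m := j - c.1.degree + (n - c.2))]
  push_cast [this]
  ring

theorem IsSatStable.degree_le_card (hU : IsSatStable U)
    {C : Finset ((Fin (n + 1) →₀ ℕ) × Fin (n + 1))} (hC : (C : Set _) = coneSet U)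
    {c : (Fin (n + 1) →₀ ℕ) × Fin (n + 1)} (hc : c ∈ C) :
    c.1.degree ≤ (C.filter fun c' => c'.2 ≤ c.2 ∧ c'.1.degree < c.1.degree).card := by
  have hmem : ∀ {c}, c ∈ C ↔ c ∈ coneSet U := fun {c} => by rw [← hC, Finset.mem_coe]
  have hsub : Finset.range c.1.degree ⊆
      (C.filter fun c' => c'.2 ≤ c.2 ∧ c'.1.degree < c.1.degree).image fun c' => c'.1.degree := by
    intro s hs
    rw [Finset.mem_range] at hs
    obtain ⟨c', hc', h1, h2⟩ := hU.exists_mem_coneSet_degree_eq (hmem.1 hc) hs.le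
    exact Finset.mem_image.2
      ⟨c', Finset.mem_filter.2 ⟨hmem.2 hc', h2, by rwa [h1]⟩, h1⟩
  have := (Finset.card_le_card hsub).trans Finset.card_image_le
  rwa [Finset.card_range] at this

/-- If the Hilbert polynomial is `standardHilbertPoly d b`, there are at most `b 0` cones, and each
has at most `d + 1` free variables. -/
theorem IsSatStable.card_le_and_le (hU : IsSatStable U)
    {C : Finset ((Fin (n + 1) →₀ ℕ) × Fin (n + 1))} (hC : (C : Set _) = coneSet U)
    {d : ℕ} {b : Fin (d + 1) → ℤ} (hb : Antitone b) (hpos : 0 < b (Fin.last d))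
    (hp : ∀ᶠ j : ℕ in Filter.atTop,
      (complCount U j : ℚ) = (standardHilbertPoly d b).eval (j : ℚ)) :
    (C.card : ℤ) ≤ b 0 ∧ ∀ c ∈ C, n - (c.2 : ℕ) ≤ d := by
  have hnonneg : ∀ i, 0 ≤ b i := fun i => hpos.le.trans (hb (Fin.le_last i))
  set b' : ℕ → ℕ := fun i => if h : i < d + 1 then (b ⟨i, h⟩).toNat else 0 with hb'
  have hb'0 : ∀ i, d < i → b' i = 0 := fun i hi => dif_neg (by omega)
  have hb'eq : ∀ i : Fin (d + 1), (b' i : ℤ) = b i := fun i => by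
    rw [hb']
    simp only [i.2, dif_pos]
    exact Int.toNat_of_nonneg (hnonneg i)
  have hb'anti : Antitone b' := by
    intro i k hik
    by_cases hk : k < d + 1
    · have h1 := hb'eq ⟨i, by omega⟩
      have h2 := hb'eq ⟨k, hk⟩
      have h3 := hb (show (⟨i, by omega⟩ : Fin (d + 1)) ≤ ⟨k, hk⟩ from hik)
      simp only at h1 h2
      omega
    · rw [hb'0 k (by omega)]
      exact Nat.zero_le _
  set T : ℕ → Multiset ℕ := fun a =>
    (C.filter fun c => n - (c.2 : ℕ) = a).val.map fun c => c.1.degree with hT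
  have hTcard : ∀ a, (T a).card = (C.filter fun c => n - (c.2 : ℕ) = a).card := fun a => by
    rw [hT]
    exact Multiset.card_map _ _
  have hsum := hU.eq_sum_conePoly hC hp
  rw [standardHilbertPoly_eq_gotzmannPoly (D := n + d) hb'anti hb'eq hb'0 (by omega)] at hsum
  have hmaps : ∀ c ∈ C, n - (c.2 : ℕ) ∈ Finset.range (n + d + 1) := fun c _ => by
    rw [Finset.mem_range]
    omega
  obtain ⟨h1, h2⟩ := card_le_of_sum_eq_gotzmannPoly (n + d) T hb'anti (by
    intro a ha t ht
    rw [hT, Multiset.mem_map] at ht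
    obtain ⟨c, hca, rfl⟩ := ht
    obtain ⟨hc, rfl⟩ := Finset.mem_filter.1 (Finset.mem_def.2 hca)
    refine (hU.degree_le_card hC hc).trans ?_
    rw [hb'0 _ (by omega), zero_add]
    -- A cone before `c` has larger dimension, or the same dimension and smaller degree.
    have hdisj : ∑ e ∈ Finset.Ico (n - (c.2 : ℕ) + 1) (n + d + 1), (T e).card
        = (C.filter fun c' => n - (c'.2 : ℕ) ∈
            Finset.Ico (n - (c.2 : ℕ) + 1) (n + d + 1)).card := by
      have hmaps' : ∀ c' ∈ C.filter fun c' => n - (c'.2 : ℕ) ∈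
          Finset.Ico (n - (c.2 : ℕ) + 1) (n + d + 1),
          n - (c'.2 : ℕ) ∈ Finset.Ico (n - (c.2 : ℕ) + 1) (n + d + 1) :=
        fun c' hc' => (Finset.mem_filter.1 hc').2
      rw [Finset.card_eq_sum_card_fiberwise hmaps']
      refine Finset.sum_congr rfl fun e he => ?_
      rw [hTcard, Finset.filter_filter]
      congr 1
      refine Finset.filter_congr fun c' _ => ?_
      constructor
      · rintro rfl
        exact ⟨he, rfl⟩
      · exact fun h => h.2
    have hsame : ((T (n - (c.2 : ℕ))).filter (· < c.1.degree)).card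
        = (C.filter fun c' => n - (c'.2 : ℕ) = n - (c.2 : ℕ) ∧
            c'.1.degree < c.1.degree).card := by
      rw [hT, Multiset.filter_map, Multiset.card_map, ← Finset.filter_filter]
      rfl
    rw [hdisj, hsame]
    refine le_trans (Finset.card_le_card ?_) (Finset.card_union_le _ _)
    intro c' hc'
    obtain ⟨hc', hle, hlt⟩ := Finset.mem_filter.1 hc'
    rw [Finset.mem_union, Finset.mem_filter, Finset.mem_filter, Finset.mem_Ico]
    have := Fin.le_def.1 hle
    by_cases heq : n - (c'.2 : ℕ) = n - (c.2 : ℕ)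
    · exact Or.inr ⟨hc', heq, hlt⟩
    · refine Or.inl ⟨hc', ?_, ?_⟩ <;> omega) (by
    rw [hsum, ← Finset.sum_fiberwise_of_maps_to hmaps]
    refine Finset.sum_congr rfl fun a _ => ?_
    rw [hT, Multiset.map_map]
    refine Finset.sum_congr rfl fun c hc => ?_
    rw [Function.comp_apply, (Finset.mem_filter.1 hc).2])
  constructor
  · rw [← hb'eq 0]
    rw [hb'0 _ (by omega), zero_add] at h1
    simp_rw [hTcard] at h1
    rw [← Finset.card_eq_sum_card_fiberwise hmaps] at h1
    exact_mod_cast h1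
  · intro c hc
    by_contra! hlt
    have := h2 (n - c.2) (by omega) (by
      intro h0
      have h3 := hTcard (n - c.2)
      rw [h0, Multiset.card_zero, eq_comm, Finset.card_eq_zero] at h3
      exact Finset.notMem_empty c (h3 ▸ Finset.mem_filter.2 ⟨hc, rfl⟩))
    rw [hb'0 _ hlt] at this
    omega

theorem IsSatStable.injOn_coneSet :
    Set.InjOn coneSet {U : Set (Fin (n + 1) →₀ ℕ) | IsSatStable U} := by
  have aux : ∀ {U V : Set (Fin (n + 1) →₀ ℕ)}, IsSatStable U → IsSatStable V →
      coneSet U = coneSet V → U ⊆ V := by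
    intro U V hU hV h A hA
    by_contra hAV
    obtain ⟨c, hc, hcA⟩ := hV.exists_mem_coneSet hAV
    exact hU.notMem_of_mem_coneSet (h ▸ hc) hcA hA
  exact fun U hU V hV h => (aux hU hV h).antisymm (aux hV hU h.symm)

end Cones

/-! ### Finiteness and independence of the number of variables -/

/-- The exponent sets of the saturated strongly stable ideals with Hilbert polynomial `p`. -/
def satStableSets (n : ℕ) (p : Polynomial ℚ) : Set (Set (Fin (n + 1) →₀ ℕ)) :=
  {U | IsSatStable U ∧ ∀ᶠ j : ℕ in Filter.atTop, (complCount U j : ℚ) = p.eval (j : ℚ)}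

section

variable {n d : ℕ} {b : Fin (d + 1) → ℤ}

theorem finite_satStableSets (n : ℕ) (hb : Antitone b) (hpos : 0 < b (Fin.last d)) :
    (satStableSets n (standardHilbertPoly d b)).Finite := by
  have hfin : {c : (Fin (n + 1) →₀ ℕ) × Fin (n + 1) | c.1.degree < (b 0).toNat}.Finite := by
    refine ((Finsupp.finite_of_degree_lt (b 0).toNat).prod
      (Set.finite_univ (α := Fin (n + 1)))).subset fun c hc => ⟨hc, Set.mem_univ _⟩
  refine Set.Finite.of_finite_image (f := coneSet) (hfin.finite_subsets.subset ?_)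
    (IsSatStable.injOn_coneSet.mono fun U hU => hU.1)
  rintro _ ⟨U, ⟨hU, hp⟩, rfl⟩ c hc
  have hC : ((finite_coneSet hU.add_mem).toFinset : Set _) = coneSet U :=
    Set.Finite.coe_toFinset _
  have hcC : c ∈ (finite_coneSet hU.add_mem).toFinset := by rwa [Set.Finite.mem_toFinset]
  have h1 := (hU.card_le_and_le hC hb hpos hp).1
  have h2 := hU.degree_le_card hC hcC
  have h3 : ((finite_coneSet hU.add_mem).toFinset.filter
      fun c' => c'.2 ≤ c.2 ∧ c'.1.degree < c.1.degree).card
        < (finite_coneSet hU.add_mem).toFinset.card :=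
    Finset.card_lt_card (Finset.filter_ssubset.2 ⟨c, hcC, fun h => lt_irrefl _ h.2⟩)
  change c.1.degree < (b 0).toNat
  omega

/-- If no variable lies in `U`, then each variable outside the cone of `1` generates a cone of
its own, which bounds the number of variables. -/
theorem IsSatStable.single_zero_mem {U : Set (Fin (n + 1) →₀ ℕ)} (hU : IsSatStable U)
    (hb : Antitone b) (hpos : 0 < b (Fin.last d))
    (hp : ∀ᶠ j : ℕ in Filter.atTop,
      (complCount U j : ℚ) = (standardHilbertPoly d b).eval (j : ℚ))
    (hn : b 0 + d ≤ n) : Finsupp.single 0 1 ∈ U := by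
  by_contra h0
  have hX : ∀ i, Finsupp.single i 1 ∉ U := fun i hi => by
    have := hU.move_single_mem (A := 0) (Fin.zero_le i) (by rwa [zero_add])
    rw [zero_add] at this
    exact h0 this
  have h1U : (0 : Fin (n + 1) →₀ ℕ) ∉ U := fun h => by
    have := hU.add_mem _ h (Finsupp.single 0 1)
    rw [zero_add] at this
    exact h0 this
  have hinit0 : ∀ i, initialPart i (0 : Fin (n + 1) →₀ ℕ) = 0 := fun i =>
    initialPart_eq_self_iff.2 fun _ _ => rfl
  obtain ⟨c₀, hc₀, h₀⟩ := hU.exists_mem_coneSet h1U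
  rw [hinit0] at h₀
  have hC : ((finite_coneSet hU.add_mem).toFinset : Set _) = coneSet U :=
    Set.Finite.coe_toFinset _
  set C := (finite_coneSet hU.add_mem).toFinset with hCdef
  have hmem : ∀ {c}, c ∈ C ↔ c ∈ coneSet U := fun {c} => by rw [← hC, Finset.mem_coe]
  obtain ⟨hcard, hlev⟩ := hU.card_le_and_le hC hb hpos hp
  have hlev0 := hlev c₀ (hmem.2 hc₀)
  have hsub : insert 0 ((Finset.Iio c₀.2).image fun i => Finsupp.single i 1)
      ⊆ C.image Prod.fst := by
    intro m hm
    rw [Finset.mem_insert, Finset.mem_image] at hm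
    rcases hm with rfl | ⟨i, hi, rfl⟩
    · exact Finset.mem_image.2 ⟨c₀, hmem.2 hc₀, h₀.symm⟩
    · rw [Finset.mem_Iio] at hi
      obtain ⟨c, hc, h⟩ := hU.exists_mem_coneSet (hX i)
      refine Finset.mem_image.2 ⟨c, hmem.2 hc, ?_⟩
      by_cases hci : (c.2 : ℕ) ≤ i
      · have hz : c.1 = 0 := by
          rw [← h, ← zero_add (Finsupp.single i 1), initialPart_add_of_le hci, hinit0]
        have := eq_of_mem_coneSet hc hc₀ (A := 0) (by rw [hinit0, hz]) (by rw [hinit0, h₀])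
        rw [this] at hci
        exact absurd (Fin.le_def.2 hci) (not_le.2 hi)
      · rw [← h, initialPart_eq_self_iff]
        intro x hx
        rw [Finsupp.single_apply, if_neg]
        rintro rfl
        exact hci hx
  have hle := (Finset.card_le_card hsub).trans Finset.card_image_le
  rw [Finset.card_insert_of_notMem, Finset.card_image_of_injective, Fin.card_Iio] at hle
  · omega
  · exact Finsupp.single_left_injective one_ne_zero
  · rw [Finset.mem_image]
    rintro ⟨i, -, hi⟩
    exact one_ne_zero (Finsupp.single_eq_zero.1 hi)

end

section

variable {n : ℕ}

/-- The exponent set of the ideal obtained by adding a new first variable to the ring and to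
the ideal. -/
def addVariable (U : Set (Fin (n + 1) →₀ ℕ)) : Set (Fin (n + 1 + 1) →₀ ℕ) :=
  {A | A 0 ≠ 0 ∨ Finsupp.tail A ∈ U}

theorem mem_addVariable {U : Set (Fin (n + 1) →₀ ℕ)} {A : Fin (n + 1 + 1) →₀ ℕ} :
    A ∈ addVariable U ↔ A 0 ≠ 0 ∨ Finsupp.tail A ∈ U := Iff.rfl

theorem cons_zero_mem_addVariable {U : Set (Fin (n + 1) →₀ ℕ)} {B : Fin (n + 1) →₀ ℕ} :
    Finsupp.cons 0 B ∈ addVariable U ↔ B ∈ U := by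
  simp [mem_addVariable]

theorem addVariable_injective :
    Function.Injective (addVariable : Set (Fin (n + 1) →₀ ℕ) → _) := by
  intro U V h
  ext B
  rw [← cons_zero_mem_addVariable, h, cons_zero_mem_addVariable]

theorem tail_add (A B : Fin (n + 1 + 1) →₀ ℕ) :
    Finsupp.tail (A + B) = Finsupp.tail A + Finsupp.tail B := by
  ext i
  simp [Finsupp.tail_apply]

theorem tail_single_succ (i : Fin (n + 1)) (k : ℕ) :
    Finsupp.tail (Finsupp.single i.succ k) = Finsupp.single i k := by
  rw [← Finsupp.cons_zero_single_eq_single_succ, Finsupp.tail_cons]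

theorem cons_zero_add (A B : Fin (n + 1) →₀ ℕ) :
    (Finsupp.cons 0 (A + B) : Fin (n + 1 + 1) →₀ ℕ) = Finsupp.cons 0 A + Finsupp.cons 0 B := by
  ext i
  refine Fin.cases ?_ (fun i => ?_) i <;> simp

theorem degree_cons_zero (B : Fin (n + 1) →₀ ℕ) :
    (Finsupp.cons 0 B : Fin (n + 1 + 1) →₀ ℕ).degree = B.degree := by
  rw [Finsupp.degree_eq_sum, Finsupp.degree_eq_sum, Fin.sum_univ_succ]
  simp

theorem IsSatStable.addVariable {U : Set (Fin (n + 1) →₀ ℕ)} (hU : IsSatStable U) :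
    IsSatStable (addVariable U) where
  add_mem A hA B := by
    rcases hA with hA | hA
    · left
      rw [Finsupp.add_apply]
      omega
    · right
      rw [tail_add]
      exact hU.add_mem _ hA _
  move_mem A i j hij h := by
    rcases Fin.eq_zero_or_eq_succ i with rfl | ⟨i, rfl⟩
    · left
      simp
    · obtain ⟨j, rfl⟩ := Fin.exists_succ_eq.2 (Fin.ne_zero_of_lt hij)
      rw [mem_addVariable, tail_add, tail_single_succ, Finsupp.add_apply,
        Finsupp.single_eq_of_ne (Fin.succ_ne_zero _).symm] at h ⊢
      exact h.imp id (hU.move_mem _ _ _ (Fin.succ_lt_succ_iff.1 hij))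
  mem_of_add_last A h := by
    rw [← Fin.succ_last, mem_addVariable, tail_add, tail_single_succ, Finsupp.add_apply,
      Finsupp.single_eq_of_ne (Fin.succ_ne_zero _).symm] at h
    exact h.imp id (hU.mem_of_add_last _)

theorem IsSatStable.comap_cons_zero {V : Set (Fin (n + 1 + 1) →₀ ℕ)} (hV : IsSatStable V) :
    IsSatStable {B : Fin (n + 1) →₀ ℕ | Finsupp.cons 0 B ∈ V} where
  add_mem A hA B := by
    rw [Set.mem_ofPred_eq, cons_zero_add]
    exact hV.add_mem _ hA _
  move_mem A i j hij h := by
    rw [Set.mem_ofPred_eq, cons_zero_add, Finsupp.cons_zero_single_eq_single_succ] at h ⊢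
    exact hV.move_mem _ _ _ (Fin.succ_lt_succ_iff.2 hij) h
  mem_of_add_last A h := by
    rw [Set.mem_ofPred_eq, cons_zero_add, Finsupp.cons_zero_single_eq_single_succ,
      Fin.succ_last] at h
    exact hV.mem_of_add_last _ h

theorem addVariable_comap_cons_zero {V : Set (Fin (n + 1 + 1) →₀ ℕ)} (hV : IsSatStable V)
    (h0 : Finsupp.single 0 1 ∈ V) :
    addVariable {B : Fin (n + 1) →₀ ℕ | Finsupp.cons 0 B ∈ V} = V := by
  ext A
  rw [mem_addVariable, Set.mem_ofPred_eq]
  by_cases hA : A 0 = 0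
  · have : Finsupp.cons 0 (Finsupp.tail A) = A := by
      conv_rhs => rw [← Finsupp.cons_tail A, hA]
    rw [this]
    simp [hA]
  · refine iff_of_true (Or.inl hA) ?_
    have hle : Finsupp.single 0 1 ≤ A := by
      rw [Finsupp.single_le_iff]
      omega
    rw [← add_tsub_cancel_of_le hle]
    exact hV.add_mem _ h0 _

theorem complCount_addVariable (U : Set (Fin (n + 1) →₀ ℕ)) (j : ℕ) :
    complCount (addVariable U) j = complCount U j := by
  have : {A | A ∉ addVariable U ∧ A.degree = j}
      = Finsupp.cons 0 '' {B : Fin (n + 1) →₀ ℕ | B ∉ U ∧ B.degree = j} := by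
    ext A
    constructor
    · rintro ⟨h1, h2⟩
      rw [mem_addVariable, not_or, not_not] at h1
      have hA : Finsupp.cons 0 (Finsupp.tail A) = A := by
        conv_rhs => rw [← Finsupp.cons_tail A, h1.1]
      refine ⟨Finsupp.tail A, ⟨h1.2, ?_⟩, hA⟩
      rw [← degree_cons_zero, hA, h2]
    · rintro ⟨B, ⟨h1, h2⟩, rfl⟩
      exact ⟨fun h => h1 (cons_zero_mem_addVariable.1 h), by rw [degree_cons_zero, h2]⟩
  rw [complCount, this, Set.ncard_image_of_injective _ (Finsupp.cons_right_injective 0), complCount]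

theorem satStableSets_succ {d : ℕ} {b : Fin (d + 1) → ℤ} (hb : Antitone b)
    (hpos : 0 < b (Fin.last d)) (hn : b 0 + d - 1 ≤ n) :
    satStableSets (n + 1) (standardHilbertPoly d b)
      = addVariable '' satStableSets n (standardHilbertPoly d b) := by
  ext V
  constructor
  · rintro ⟨hV, hp⟩
    have h0 := hV.single_zero_mem hb hpos hp (by push_cast; omega)
    have hVeq := addVariable_comap_cons_zero hV h0
    refine ⟨_, ⟨hV.comap_cons_zero, ?_⟩, hVeq⟩
    rw [← hVeq] at hp
    simpa only [complCount_addVariable] using hp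
  · rintro ⟨U, ⟨hU, hp⟩, rfl⟩
    exact ⟨hU.addVariable, by simpa only [complCount_addVariable] using hp⟩

end

/-! ### Ideals and exponent sets -/

section Ideals

variable {n : ℕ}

/-- The monomial ideal generated by the monomials with exponents in `U`. -/
noncomputable def idealOfExponents (K : Type*) [Field K] (U : Set (Fin (n + 1) →₀ ℕ)) :
    Ideal (MvPolynomial (Fin (n + 1)) K) :=
  Ideal.span ((fun A => monomial A (1 : K)) '' U)

variable {K : Type*} [Field K]

theorem mem_idealOfExponents {U : Set (Fin (n + 1) →₀ ℕ)} (hU : ∀ A ∈ U, ∀ B, A + B ∈ U)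
    {f : MvPolynomial (Fin (n + 1)) K} :
    f ∈ idealOfExponents K U ↔ ∀ A ∈ f.support, A ∈ U := by
  rw [idealOfExponents, mem_ideal_span_monomial_image]
  refine forall₂_congr fun A _ => ⟨?_, fun h => ⟨A, h, le_rfl⟩⟩
  rintro ⟨B, hB, hle⟩
  rw [← add_tsub_cancel_of_le hle]
  exact hU _ hB _

theorem monomial_mem_idealOfExponents {U : Set (Fin (n + 1) →₀ ℕ)}
    (hU : ∀ A ∈ U, ∀ B, A + B ∈ U) {A : Fin (n + 1) →₀ ℕ} :
    monomial A (1 : K) ∈ idealOfExponents K U ↔ A ∈ U := by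
  classical
  rw [mem_idealOfExponents hU, support_monomial, if_neg one_ne_zero]
  simp

theorem monomial_add_mem {I : Ideal (MvPolynomial (Fin (n + 1)) K)} {A : Fin (n + 1) →₀ ℕ}
    (hA : monomial A (1 : K) ∈ I) (B : Fin (n + 1) →₀ ℕ) : monomial (A + B) (1 : K) ∈ I := by
  have := I.mul_mem_left (monomial B 1) hA
  rwa [monomial_mul, one_mul, add_comm B A] at this

theorem IsMonomialIdeal.eq_idealOfExponents {I : Ideal (MvPolynomial (Fin (n + 1)) K)}
    (hI : IsMonomialIdeal I) : idealOfExponents K {A | monomial A (1 : K) ∈ I} = I := by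
  obtain ⟨S, rfl⟩ := hI
  refine le_antisymm (Ideal.span_le.2 ?_) (Ideal.span_mono (Set.image_mono fun A hA => ?_))
  · rintro _ ⟨A, hA, rfl⟩
    exact hA
  · exact Ideal.subset_span ⟨A, hA, rfl⟩

theorem hilbertFun_idealOfExponents {U : Set (Fin (n + 1) →₀ ℕ)}
    (hU : ∀ A ∈ U, ∀ B, A + B ∈ U) (j : ℕ) :
    hilbertFun (idealOfExponents K U) j = complCount U j := by
  set S : Set (Fin (n + 1) →₀ ℕ) := {A | A ∉ U ∧ A.degree = j} with hS
  have hfin : S.Finite := (Finsupp.finite_of_degree_eq j).subset fun A hA => hA.2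
  have := hfin.fintype
  set π := (Ideal.Quotient.mkₐ K (idealOfExponents K U)).toLinearMap with hπ
  have hker : ∀ f, π f = 0 ↔ ∀ A ∈ f.support, A ∈ U := fun f => by
    rw [← mem_idealOfExponents hU]
    exact Ideal.Quotient.eq_zero_iff_mem
  set v : S → MvPolynomial (Fin (n + 1)) K ⧸ idealOfExponents K U :=
    fun A => π (monomial A.1 1) with hv
  have hspan : (homogeneousSubmodule (Fin (n + 1)) K j).map π
      = Submodule.span K (Set.range v) := by
    apply le_antisymm
    · rintro _ ⟨f, hf, rfl⟩
      rw [f.as_sum, map_sum]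
      refine Submodule.sum_mem _ fun A hA => ?_
      have hmon : monomial A (coeff A f) = coeff A f • monomial A (1 : K) := by
        rw [smul_monomial, smul_eq_mul, mul_one]
      rw [hmon, map_smul]
      refine Submodule.smul_mem _ _ ?_
      by_cases hAU : A ∈ U
      · have h0 : π (monomial A 1) = 0 :=
          Ideal.Quotient.eq_zero_iff_mem.2 ((monomial_mem_idealOfExponents hU).2 hAU)
        rw [h0]
        exact Submodule.zero_mem _
      · refine Submodule.subset_span ⟨⟨A, hAU, ?_⟩, rfl⟩
        by_contra hne
        exact mem_support_iff.1 hA (((mem_homogeneousSubmodule j f).1 hf).coeff_eq_zero hne)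
    · rw [Submodule.span_le]
      rintro _ ⟨A, rfl⟩
      exact ⟨monomial A.1 1,
        (mem_homogeneousSubmodule j _).2 (isHomogeneous_monomial _ A.2.2), rfl⟩
  have hind : LinearIndependent K v := by
    rw [Fintype.linearIndependent_iff]
    intro g hg A
    by_contra hne
    have hsum : π (∑ B, g B • monomial B.1 (1 : K)) = 0 := by
      rw [map_sum, ← hg]
      exact Finset.sum_congr rfl fun B _ => map_smul _ _ _
    refine A.2.1 ((hker _).1 hsum A.1 (mem_support_iff.2 ?_))
    classical
    rw [coeff_sum, Finset.sum_eq_single A]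
    · simpa using hne
    · intro B _ hB
      rw [coeff_smul, coeff_monomial, if_neg (fun h => hB (Subtype.ext h)), smul_zero]
    · exact fun h => absurd (Finset.mem_univ A) h
  rw [hilbertFun, ← hπ, hspan, finrank_span_eq_card hind, complCount, ← hS,
    ← Nat.card_coe_set_eq, Nat.card_eq_fintype_card]

theorem IsStronglyStable.isSatStable {I : Ideal (MvPolynomial (Fin (n + 1)) K)}
    (hI : IsStronglyStable I) (hsat : IsSaturatedIdeal I) :
    IsSatStable {A | monomial A (1 : K) ∈ I} := by
  have hmove : ∀ A i j, i < j → monomial (A + Finsupp.single j 1) (1 : K) ∈ I →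
      monomial (A + Finsupp.single i 1) (1 : K) ∈ I := by
    intro A i j hij h
    have := hI.2 _ h j (by simp) i hij
    rwa [add_tsub_cancel_right] at this
  refine ⟨fun A hA B => monomial_add_mem hA B, hmove, fun A hA => hsat 1 _ fun g hg => ?_⟩
  rw [pow_one] at hg
  refine Submodule.span_induction (p := fun g _ => g * monomial A (1 : K) ∈ I) ?_ ?_ ?_ ?_ hg
  · rintro _ ⟨i, rfl⟩
    rw [X, monomial_mul, one_mul, add_comm _ A]
    rcases (Fin.le_last i).eq_or_lt with rfl | hi
    · exact hA
    · exact hmove _ _ _ hi hA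
  · rw [zero_mul]
    exact I.zero_mem
  · intro x y _ _ hx hy
    rw [add_mul]
    exact I.add_mem hx hy
  · intro a x _ hx
    rw [smul_eq_mul, mul_assoc]
    exact I.mul_mem_left _ hx

theorem IsSatStable.isStronglyStable {U : Set (Fin (n + 1) →₀ ℕ)} (hU : IsSatStable U) :
    IsStronglyStable (idealOfExponents K U) := by
  refine ⟨⟨U, rfl⟩, fun A hA j hj i hij => ?_⟩
  rw [monomial_mem_idealOfExponents hU.add_mem] at hA ⊢
  refine hU.move_mem _ _ _ hij ?_
  rwa [tsub_add_cancel_of_le]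
  rw [Finsupp.single_le_iff]
  omega

theorem IsSatStable.isSaturatedIdeal {U : Set (Fin (n + 1) →₀ ℕ)} (hU : IsSatStable U) :
    IsSaturatedIdeal (idealOfExponents K U) := by
  intro k f hf
  rw [mem_idealOfExponents hU.add_mem]
  intro A hA
  -- It is enough to test with the `k`-th power of the last variable.
  have h := hf (X (Fin.last n) ^ k)
    (Ideal.pow_mem_pow (Ideal.subset_span (Set.mem_range_self _)) k)
  rw [mem_idealOfExponents hU.add_mem] at h
  refine hU.mem_of_add_single_last (k := k) (h _ (mem_support_iff.2 ?_))
  rw [X_pow_eq_monomial, add_comm A, coeff_monomial_mul, one_mul]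
  exact mem_support_iff.1 hA

theorem satStronglyStableIdeals_eq_image (p : Polynomial ℚ) :
    satStronglyStableIdeals K n p = idealOfExponents K '' satStableSets n p := by
  ext I
  constructor
  · rintro ⟨hsat, hI, hp⟩
    have hU := hI.isSatStable hsat
    have heq := hI.1.eq_idealOfExponents
    refine ⟨_, ⟨hU, ?_⟩, heq⟩
    rw [HasHilbertPoly, ← heq] at hp
    simpa only [hilbertFun_idealOfExponents hU.add_mem] using hp
  · rintro ⟨U, ⟨hU, hp⟩, rfl⟩
    refine ⟨hU.isSaturatedIdeal, hU.isStronglyStable, ?_⟩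
    simpa only [HasHilbertPoly, hilbertFun_idealOfExponents hU.add_mem] using hp

theorem injOn_idealOfExponents (p : Polynomial ℚ) :
    Set.InjOn (idealOfExponents (n := n) K) (satStableSets n p) := by
  intro U hU V hV h
  ext A
  rw [← monomial_mem_idealOfExponents (K := K) hU.1.add_mem, h,
    monomial_mem_idealOfExponents hV.1.add_mem]

end Ideals

theorem proposition6p2 (K : Type*) [Field K] (p : Polynomial ℚ) (d : ℕ) (b : Fin (d + 1) → ℤ)
    (hb : Antitone b) (hpos : 0 < b (Fin.last d)) (hp : p = standardHilbertPoly d b) :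
    ∃ N : ℕ, ∀ n : ℕ, b 0 + (d : ℤ) - 1 ≤ (n : ℤ) →
      (satStronglyStableIdeals K n p).Finite ∧ (satStronglyStableIdeals K n p).ncard = N := by
  subst hp
  have hb0 : 0 < b 0 := hpos.trans_le (hb (Fin.zero_le _))
  obtain ⟨n₀, hn₀⟩ : ∃ n₀ : ℕ, b 0 + (d : ℤ) - 1 = n₀ := ⟨(b 0 + d - 1).toNat, by omega⟩
  refine ⟨(satStableSets n₀ (standardHilbertPoly d b)).ncard, fun n hn => ?_⟩
  rw [satStronglyStableIdeals_eq_image, (injOn_idealOfExponents _).ncard_image]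
  refine ⟨(finite_satStableSets n hb hpos).image _, ?_⟩
  have hle : n₀ ≤ n := by omega
  clear hn
  induction n, hle using Nat.le_induction with
  | base => rfl
  | succ n hle ih =>
    rw [satStableSets_succ hb hpos (by omega),
      Set.ncard_image_of_injective _ addVariable_injective, ih]
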